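/- **Theorem (Halin).** Let $G$ be a (simple, undirected, possibly infinite and of arbitrary cardinality) connected graph that contains no subdivision of the countably infinite complete graph $K^{\aleph_0}$ as a subgraph. Then $G$ has a normal spanning tree: there are a spanning tree $T$ of $G$ and a root $r\in V(G)$ such that for every edge $uv$ of $G$ the vertices $u$ and $v$ are comparable in the tree order $\le_T$, where $x\le_T y$ means that $x$ lies on the unique path from $r$ to $y$ in $T$. Here a subdivision of a graph $H$ is a graph obtained from $H$ by replacing its edges with paths between their ends, such that these paths have no inner vertex in $V(H)$ or on another one of these paths. -/

import Mathlib

/-- A subdivision of the graph `H` contained in `G`: injectively chosen branch vertices, one for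
every vertex of `H`, and for every edge `uv` of `H` a path in `G` between the branch vertices of
`u` and `v`, such that a path meets no branch vertices besides its ends, and the paths of
two different edges share no vertices besides branch vertices (that is, besides common ends). -/
structure SubdivisionIn {W V : Type*} (H : SimpleGraph W) (G : SimpleGraph V) where
  /-- The branch vertices. -/
  branch : W → V
  branch_injective : Function.Injective branch
  /-- The path that replaces the edge `uv`, read from `u` to `v`. -/
  path : ∀ u v : W, H.Adj u v → G.Walk (branch u) (branch v)
  path_isPath : ∀ (u v : W) (h : H.Adj u v), (path u v h).IsPath
  /-- Reading an edge in the other direction gives the same path, reversed. -/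
  path_symm : ∀ (u v : W) (h : H.Adj u v), path v u h.symm = (path u v h).reverse
  branch_mem_path : ∀ (u v : W) (h : H.Adj u v) (w : W),
    branch w ∈ (path u v h).support → w = u ∨ w = v
  path_inter_path : ∀ (u v : W) (h : H.Adj u v) (u' v' : W) (h' : H.Adj u' v'),
    s(u, v) ≠ s(u', v') → ∀ x : V, x ∈ (path u v h).support → x ∈ (path u' v' h').support →
      x ∈ Set.range branch

/-- `G` contains a subdivision of `H` as a subgraph. -/
def ContainsSubdivision {W V : Type*} (H : SimpleGraph W) (G : SimpleGraph V) : Prop :=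
  Nonempty (SubdivisionIn H G)

/-- The tree order of a tree `T` with root `r`: `u ≤ v` if `u` lies on the (unique) path
from `r` to `v` in `T`. -/
def TreeLE {V : Type*} (T : SimpleGraph V) (r u v : V) : Prop :=
  ∃ p : T.Walk r v, p.IsPath ∧ u ∈ p.support

/-- `T` with root `r` is a normal spanning tree of `G`: a tree on all the vertices of `G` whose
edges are edges of `G`, such that the ends of every edge of `G` are comparable in the tree order
of `T`. -/
structure IsNormalSpanningTree {V : Type*} (G T : SimpleGraph V) (r : V) : Prop where
  le : T ≤ G
  isTree : T.IsTree
  comparable : ∀ u v : V, G.Adj u v → TreeLE T r u v ∨ TreeLE T r v u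

/-! The bridge between the hypothesis and the tree is a ranking of the vertices by natural numbers
in which any walk between two distinct vertices of equal rank passes through a vertex of smaller
rank.

The forbidden subdivision enters through one finiteness fact. Infinitely many vertices, no two
separable by a finite set, yield a subdivision of the infinite complete graph by greedy choice of
fans. Hence, if `A` contains finite separators for all its finitely separable pairs, every vertex
has only finitely many attachments on `A` (`SepClosed.finite_attachments`).

Rankings are built by induction on the cardinality of such a set `A`. A countable set is ranked
injectively. An uncountable one is the union of an increasing well-ordered family of smaller
separator-closed sets. Each new layer is ranked in the graph without the lower layers, and
finiteness of attachments allows ranks to be lifted above those of the lower vertices that matter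
(`exists_isRanking_of_layers`).

Given a ranking of all vertices, a depth-first search for each `v` steps into the component still
containing `v`, heading for the vertex of least rank there. That vertex is unique, so each target is
eventually deleted or cut off from `v`. The target ranks are bounded by the rank of `v`, so the
search ends. Adjacent vertices share their searches until one of them is visited, which gives
normality. -/

namespace SimpleGraph

variable {V : Type*} {G : SimpleGraph V}

/-! ### Fans and subdivisions of the infinite complete graph -/

/-- Initial segment of a walk up to its first vertex in `W`. -/
theorem Walk.exists_first_hit (W : Set V) {u v : V} (p : G.Walk u v)
    (h : ∃ x ∈ p.support, x ∈ W) :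
    ∃ w ∈ W, ∃ q : G.Walk u w, (∀ y ∈ q.support, y ∈ p.support) ∧
      ∀ y ∈ q.support, y ∈ W → y = w := by
  induction p with
  | nil =>
    obtain ⟨x, hx, hxW⟩ := h
    simp only [Walk.support_nil, List.mem_singleton] at hx
    subst hx
    exact ⟨x, hxW, Walk.nil, by simp, by simp⟩
  | @cons a b c hab p ih =>
    by_cases ha : a ∈ W
    · exact ⟨a, ha, Walk.nil, by simp, by simp⟩
    · have h' : ∃ x ∈ p.support, x ∈ W := by
        obtain ⟨x, hx, hxW⟩ := h
        rw [Walk.support_cons, List.mem_cons] at hx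
        rcases hx with rfl | hx
        · exact absurd hxW ha
        · exact ⟨x, hx, hxW⟩
      obtain ⟨w, hw, q, hq1, hq2⟩ := ih h'
      refine ⟨w, hw, Walk.cons hab q, ?_, ?_⟩
      · intro y hy
        rw [Walk.support_cons, List.mem_cons] at hy ⊢
        exact hy.imp_right (hq1 y)
      · intro y hy hyW
        rw [Walk.support_cons, List.mem_cons] at hy
        rcases hy with rfl | hy
        · exact absurd hyW ha
        · exact hq2 y hy hyW

/-- A fan of paths from `b` to the members of a finite set `L`, each meeting `F` only in its
end and any two meeting only in `b`; the paths are recorded by their vertex sets. -/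
theorem exists_fan {I : Set V}
    (hI : ∀ u ∈ I, ∀ v ∈ I, u ≠ v → ∀ S : Set V, S.Finite → u ∉ S → v ∉ S →
      ∃ p : G.Walk u v, ∀ x ∈ p.support, x ∉ S)
    (F : Finset V) {b : V} (hb : b ∈ I) (hbF : b ∉ F) (L : Finset V) (hLI : ↑L ⊆ I) (hLF : L ⊆ F) :
    ∃ Q : V → Finset V, (∀ t ∈ L, ∃ p : G.Walk b t, p.IsPath ∧ ∀ x, x ∈ p.support ↔ x ∈ Q t) ∧
      (∀ t, ∀ x ∈ Q t, x ∈ F → x = t) ∧ (∀ t, t ∉ L → Q t = ∅) ∧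
      ∀ t t', t ≠ t' → ∀ x ∈ Q t, x ∈ Q t' → x = b := by
  classical
  induction L using Finset.induction_on with
  | empty => exact ⟨fun _ => ∅, by simp, by simp, by simp, by simp⟩
  | insert t₀ L ht₀ ih =>
    have ht₀I : t₀ ∈ I := hLI (by simp)
    have ht₀F : t₀ ∈ F := hLF (by simp)
    obtain ⟨Q, hQ1, hQ2, hQ3, hQ4⟩ := ih (fun x hx => hLI (by simp at hx ⊢; exact Or.inr hx))
      (fun x hx => hLF (by simp [hx]))
    have hne : b ≠ t₀ := fun h => hbF (h ▸ ht₀F)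
    -- The new path has to avoid `F` and all earlier paths of the fan, except at its own ends.
    obtain ⟨p, hp⟩ := hI b hb t₀ ht₀I hne (↑((F ∪ L.biUnion Q) \ {b, t₀}) : Set V)
      (Finset.finite_toSet _) (by simp) (by simp)
    have hpS : ∀ x ∈ p.bypass.support, x ∈ F ∪ L.biUnion Q → x = b ∨ x = t₀ := by
      intro x hx hxF
      by_contra hcon
      push Not at hcon
      refine hp x (p.support_bypass_subset_support hx) ?_
      rw [Finset.mem_coe, Finset.mem_sdiff]
      exact ⟨hxF, by simp [hcon.1, hcon.2]⟩
    have key : ∀ t, t ≠ t₀ → ∀ x ∈ Q t, x ∈ p.bypass.support → x = b := by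
      intro t ht x hx hxp
      have htL : t ∈ L := by
        by_contra hcon
        simp [hQ3 t hcon] at hx
      rcases hpS x hxp (Finset.mem_union_right _ (Finset.mem_biUnion.2 ⟨t, htL, hx⟩)) with h | h
      · exact h
      · subst h
        exact absurd (hQ2 t x hx ht₀F).symm ht
    refine ⟨Function.update Q t₀ p.bypass.support.toFinset, ?_, ?_, ?_, ?_⟩
    · intro t ht
      by_cases h : t = t₀
      · subst h
        exact ⟨p.bypass, p.bypass_isPath, by simp⟩
      · rw [Function.update_of_ne h]
        exact hQ1 t ((Finset.mem_insert.1 ht).resolve_left h)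
    · intro t x hx hxF
      by_cases h : t = t₀
      · subst h
        rw [Function.update_self, List.mem_toFinset] at hx
        rcases hpS x hx (Finset.mem_union_left _ hxF) with h | h
        · exact absurd (h ▸ hxF) hbF
        · exact h
      · rw [Function.update_of_ne h] at hx
        exact hQ2 t x hx hxF
    · intro t ht
      rw [Finset.mem_insert, not_or] at ht
      rw [Function.update_of_ne ht.1]
      exact hQ3 t ht.2
    · intro t t' htt' x hx hx'
      by_cases h : t = t₀
      · subst h
        rw [Function.update_of_ne htt'.symm] at hx'
        rw [Function.update_self, List.mem_toFinset] at hx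
        exact key t' htt'.symm x hx' hx
      · rw [Function.update_of_ne h] at hx
        by_cases h' : t' = t₀
        · subst h'
          rw [Function.update_self, List.mem_toFinset] at hx'
          exact key t h x hx hx'
        · rw [Function.update_of_ne h'] at hx'
          exact hQ4 t t' htt' x hx hx'

/-- An infinite set of vertices no two of which can be separated by a finite set yields a
subdivision of the countably infinite complete graph. -/
theorem containsSubdivision_top_of_infinite {I : Set V} (hinf : I.Infinite)
    (hI : ∀ u ∈ I, ∀ v ∈ I, u ≠ v → ∀ S : Set V, S.Finite → u ∉ S → v ∉ S →
      ∃ p : G.Walk u v, ∀ x ∈ p.support, x ∉ S) :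
    ContainsSubdivision (⊤ : SimpleGraph ℕ) G := by
  classical
  -- Each term consists of a branch vertex, a finite set containing it and its fan, and the fan
  -- towards the earlier branch vertices. Later fans meet that finite set only in their targets.
  obtain ⟨f, hf⟩ := exists_seq_of_forall_finset_exists
    (α := V × Finset V × (V → Finset V))
    (fun y => y.1 ∈ I ∧ y.1 ∈ y.2.1 ∧ (∀ t, y.2.2 t ⊆ y.2.1) ∧
      ∀ t t', t ≠ t' → ∀ x ∈ y.2.2 t, x ∈ y.2.2 t' → x = y.1)
    (fun x y => y.1 ∉ x.2.1 ∧
      (∃ p : G.Walk y.1 x.1, p.IsPath ∧ ∀ z, z ∈ p.support ↔ z ∈ y.2.2 x.1) ∧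
      ∀ t, ∀ z ∈ y.2.2 t, z ∈ x.2.1 → z = t) (by
    intro s hs
    obtain ⟨b, hbI, hbF⟩ := hinf.exists_notMem_finset (s.biUnion fun x => x.2.1)
    obtain ⟨Q, hQ1, hQ2, hQ3, hQ4⟩ := exists_fan hI (s.biUnion fun x => x.2.1) hbI hbF
      (s.image Prod.fst)
      (by
        intro x hx
        simp only [Finset.coe_image, Set.mem_image, Finset.mem_coe] at hx
        obtain ⟨y, hy, rfl⟩ := hx
        exact (hs y hy).1)
      (by
        intro x hx
        obtain ⟨y, hy, rfl⟩ := Finset.mem_image.1 hx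
        exact Finset.mem_biUnion.2 ⟨y, hy, (hs y hy).2.1⟩)
    refine ⟨(b, insert b ((s.image Prod.fst).biUnion Q), Q), ⟨hbI, by simp, ?_, hQ4⟩, ?_⟩
    · intro t x hx
      by_cases ht : t ∈ s.image Prod.fst
      · exact Finset.mem_insert_of_mem (Finset.mem_biUnion.2 ⟨t, ht, hx⟩)
      · simp [hQ3 t ht] at hx
    · intro x hx
      refine ⟨fun h => hbF (Finset.mem_biUnion.2 ⟨x, hx, h⟩),
        hQ1 _ (Finset.mem_image_of_mem _ hx), fun t z hz hzx => ?_⟩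
      exact hQ2 t z hz (Finset.mem_biUnion.2 ⟨x, hx, hzx⟩))
  obtain ⟨hP, hr⟩ := hf
  choose walk hpath hsupp using fun (m n : ℕ) (h : m < n) => (hr m n h).2.1
  have hinj : Function.Injective fun n => (f n).1 := by
    intro m n hmn
    by_contra hne
    rcases lt_or_gt_of_ne hne with h | h
    · exact (hr m n h).1 (by rw [← show (f m).1 = (f n).1 from hmn]; exact (hP m).2.1)
    · exact (hr n m h).1 (by rw [show (f m).1 = (f n).1 from hmn]; exact (hP n).2.1)
  have hbranch : ∀ (m n : ℕ) (h : m < n) (w : ℕ), (f w).1 ∈ (walk m n h).support →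
      w = m ∨ w = n := by
    intro m n h w hw
    rw [hsupp] at hw
    rcases lt_trichotomy w n with hwn | rfl | hwn
    · exact Or.inl (hinj ((hr w n hwn).2.2 _ _ hw (hP w).2.1))
    · exact Or.inr rfl
    · exact absurd ((hP n).2.2.1 _ hw) (hr n w hwn).1
  have hinter : ∀ (m n : ℕ) (h : m < n) (m' n' : ℕ) (h' : m' < n'), n ≤ n' →
      ¬ (m = m' ∧ n = n') → ∀ x, x ∈ (walk m n h).support → x ∈ (walk m' n' h').support →
      x ∈ Set.range fun n => (f n).1 := by
    intro m n h m' n' h' hnn hne x hx hx'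
    rw [hsupp] at hx hx'
    rcases hnn.lt_or_eq with hlt | rfl
    -- The path for `m'`, `n'` lies in the fan of the later vertex `n'`, so it can meet the finite
    -- set of `n` only in its target, the branch vertex of `m'`.
    · exact ⟨m', ((hr n n' hlt).2.2 _ x hx' ((hP n).2.2.1 _ hx)).symm⟩
    · exact ⟨n, ((hP n).2.2.2 (f m).1 (f m').1 (fun e => hne ⟨hinj e, rfl⟩) x hx hx').symm⟩
  have hgt : ∀ {u v : ℕ}, (⊤ : SimpleGraph ℕ).Adj u v → ¬ u < v → v < u := fun h h' =>
    lt_of_le_of_ne (not_lt.1 h') (Ne.symm h.ne)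
  have hall : ∀ (u v : ℕ) (h : (⊤ : SimpleGraph ℕ).Adj u v), ∃ m n, ∃ hmn : m < n,
      s(u, v) = s(m, n) ∧ ∀ x, x ∈ (if h' : u < v then (walk u v h').reverse
        else walk v u (hgt h h')).support ↔ x ∈ (walk m n hmn).support := by
    intro u v h
    by_cases h' : u < v
    · exact ⟨u, v, h', rfl, by simp [h']⟩
    · exact ⟨v, u, hgt h h', Sym2.eq_swap, by simp [h']⟩
  refine ⟨{ branch := fun n => (f n).1
            branch_injective := hinj
            path := fun u v h => if h' : u < v then (walk u v h').reverse
              else walk v u (hgt h h')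
            path_isPath := ?_
            path_symm := ?_
            branch_mem_path := ?_
            path_inter_path := ?_ }⟩
  · intro u v h
    split_ifs with h'
    · exact (hpath _ _ _).reverse
    · exact hpath _ _ _
  · intro u v h
    by_cases h' : u < v
    · simp [h', h'.not_gt]
    · simp [h', hgt h h']
  · intro u v h w hw
    obtain ⟨m, n, hmn, he, hs⟩ := hall u v h
    rw [hs] at hw
    have := hbranch m n hmn w hw
    rcases Sym2.eq_iff.1 he with ⟨rfl, rfl⟩ | ⟨rfl, rfl⟩
    · exact this
    · exact this.symm
  · intro u v h u' v' h' hne x hx hx'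
    obtain ⟨m, n, hmn, he, hs⟩ := hall u v h
    obtain ⟨m', n', hmn', he', hs'⟩ := hall u' v' h'
    rw [hs] at hx
    rw [hs'] at hx'
    rw [he, he'] at hne
    rcases le_total n n' with hle | hle
    · exact hinter m n hmn m' n' hmn' hle (fun e => hne (by rw [e.1, e.2])) x hx hx'
    · exact hinter m' n' hmn' m n hmn hle (fun e => hne (by rw [e.1, e.2])) x hx' hx

/-! ### Finite separators and attachments -/

open Cardinal

/-- Every walk from `u` to `v` that avoids `X` meets `S`, and `S` contains neither end. -/
def Separates (G : SimpleGraph V) (X S : Set V) (u v : V) : Prop :=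
  u ∉ S ∧ v ∉ S ∧ ∀ p : G.Walk u v, (∀ x ∈ p.support, x ∉ X) → ∃ x ∈ p.support, x ∈ S

/-- Any two vertices of `A` that some finite set separates in `G - X` are separated there by a
finite subset of `A`. -/
def SepClosed (G : SimpleGraph V) (X A : Set V) : Prop :=
  ∀ u ∈ A, ∀ v ∈ A, (∃ S : Set V, S.Finite ∧ G.Separates X S u v) →
    ∃ S ⊆ A, S.Finite ∧ G.Separates X S u v

/-- The vertices of `A` that can be reached from `c` in `G - X` without meeting `A` before. -/
def attachments (G : SimpleGraph V) (X A : Set V) (c : V) : Set V :=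
  {w | w ∈ A ∧ ∃ p : G.Walk c w, (∀ x ∈ p.support, x ∉ X) ∧ ∀ x ∈ p.support, x ∈ A → x = w}

/-- Two attachments `u`, `v` of `c` are joined through `c` by a walk that meets `A` only in `u` and
`v`. No separator inside `A` can hit this walk, so by closedness no finite set separates them, and
infinitely many attachments would produce the forbidden subdivision. -/
theorem SepClosed.finite_attachments (hK : ¬ ContainsSubdivision (⊤ : SimpleGraph ℕ) G)
    {X A : Set V} (hA : G.SepClosed X A) (c : V) : (G.attachments X A c).Finite := by
  by_contra hinf
  refine hK (containsSubdivision_top_of_infinite hinf ?_)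
  rintro u ⟨huA, p, hpX, hpA⟩ v ⟨hvA, q, hqX, hqA⟩ - S hS huS hvS
  by_contra hcon
  push Not at hcon
  obtain ⟨S', hS'A, -, hu, hv, hsep⟩ :=
    hA u huA v hvA ⟨S, hS, huS, hvS, fun r _ => hcon r⟩
  obtain ⟨x, hx, hxS⟩ := hsep (p.reverse.append q) (by
    intro x hx
    rw [Walk.mem_support_append_iff, Walk.support_reverse, List.mem_reverse] at hx
    exact hx.elim (hpX x) (hqX x))
  rw [Walk.mem_support_append_iff, Walk.support_reverse, List.mem_reverse] at hx
  rcases hx with hx | hx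
  · exact hu (hpA x hx (hS'A hxS) ▸ hxS)
  · exact hv (hqA x hx (hS'A hxS) ▸ hxS)

theorem attachments_subset_of_walk {X A : Set V} {c d : V} (p : G.Walk c d)
    (hp : ∀ x ∈ p.support, x ∉ X ∪ A) : G.attachments X A d ⊆ G.attachments X A c := by
  rintro w ⟨hw, q, hqX, hqA⟩
  refine ⟨hw, p.append q, ?_, ?_⟩
  · intro x hx
    rw [Walk.mem_support_append_iff] at hx
    exact hx.elim (fun h h' => hp x h (Or.inl h')) (hqX x)
  · intro x hx hxA
    rw [Walk.mem_support_append_iff] at hx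
    exact hx.elim (fun h => absurd (Or.inr hxA) (hp x h)) (fun h => hqA x h hxA)

theorem exists_attachment_mem_support {X A : Set V} {c d : V} (p : G.Walk c d)
    (hp : ∀ x ∈ p.support, x ∉ X) (h : ∃ x ∈ p.support, x ∈ A) :
    ∃ w ∈ p.support, w ∈ G.attachments X A c := by
  obtain ⟨w, hw, q, hq1, hq2⟩ := p.exists_first_hit A h
  exact ⟨w, hq1 w q.end_mem_support, hw, q, fun x hx => hp x (hq1 x hx), hq2⟩

/-- A walk from `u` that enters `W` passes through an attachment of `u` on `W`. Adding these
finitely many vertices turns a separator in the graph without `X ∪ W` into one in the graph without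
`X`. Closedness of `U` moves it into `U`, and its part in `W` is not needed once `W` is deleted. -/
theorem SepClosed.diff {X W U : Set V} (hU : G.SepClosed X U)
    (hfin : ∀ c, (G.attachments X W c).Finite) : G.SepClosed (X ∪ W) (U \ W) := by
  rintro u ⟨huU, huW⟩ v ⟨hvU, hvW⟩ ⟨S, hS, huS, hvS, hsep⟩
  obtain ⟨S', hS'U, hS', hu', hv', hsep'⟩ := hU u huU v hvU
    ⟨S ∪ G.attachments X W u, hS.union (hfin u), fun h => h.elim huS (fun h => huW h.1),
      fun h => h.elim hvS (fun h => hvW h.1), fun p hp => by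
        by_cases hpW : ∃ x ∈ p.support, x ∈ W
        · obtain ⟨w, hw, hwa⟩ := exists_attachment_mem_support p hp hpW
          exact ⟨w, hw, Or.inr hwa⟩
        · push Not at hpW
          obtain ⟨x, hx, hxS⟩ := hsep p fun x hx h => h.elim (hp x hx) (hpW x hx)
          exact ⟨x, hx, Or.inl hxS⟩⟩
  refine ⟨S' \ W, Set.sdiff_subset_sdiff_left hS'U, hS'.sdiff, fun h => hu' h.1, fun h => hv' h.1,
    fun p hp => ?_⟩
  obtain ⟨x, hx, hxS⟩ := hsep' p fun x hx h => hp x hx (Or.inl h)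
  exact ⟨x, hx, hxS, fun h => hp x hx (Or.inr h)⟩

/-! ### Vertex rankings -/

/-- A vertex ranking of `A` in `G - X`: every walk between two vertices of the same rank contains
a vertex of smaller rank. -/
def IsRanking (G : SimpleGraph V) (X A : Set V) (ρ : V → ℕ) : Prop :=
  ∀ u ∈ A, ∀ v ∈ A, u ≠ v → ρ u = ρ v → ∀ p : G.Walk u v, (∀ x ∈ p.support, x ∉ X) →
    ∃ w ∈ p.support, w ∈ A ∧ ρ w < ρ u

theorem exists_isRanking_of_countable (X : Set V) {A : Set V} (hA : A.Countable) :
    ∃ ρ, G.IsRanking X A ρ := by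
  obtain ⟨ρ, hρ⟩ := Set.countable_iff_exists_injOn.1 hA
  exact ⟨ρ, fun u hu v hv hne h => absurd (hρ hu hv h) hne⟩

/-- Rankings of the layers of a well-ordered decomposition combine to a ranking, if every vertex
has only finitely many attachments on the union of the lower layers. -/
theorem exists_isRanking_of_layers {ι : Type*} [LinearOrder ι] [WellFoundedLT ι] (idx : V → ι)
    (X A : Set V)
    (hfin : ∀ a c, (G.attachments X {v | v ∈ A ∧ idx v < a} c).Finite)
    (hrank : ∀ a, ∃ σ, G.IsRanking (X ∪ {v | v ∈ A ∧ idx v < a}) {v | v ∈ A ∧ idx v = a} σ) :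
    ∃ ρ, G.IsRanking X A ρ := by
  choose σ hσ using hrank
  let N : V → Finset V := fun u => (hfin (idx u) u).toFinset
  have hN : ∀ u w, w ∈ N u ↔ w ∈ G.attachments X {v | v ∈ A ∧ idx v < idx u} u := fun u w =>
    Set.Finite.mem_toFinset _
  have hwf : WellFounded (InvImage (· < ·) idx : V → V → Prop) :=
    InvImage.wf idx wellFounded_lt
  -- The supremum puts `u` above all its attachments on lower layers. The summand `σ` orders
  -- vertices of one layer that have the same attachments.
  let ρ : V → ℕ := hwf.fix fun u rec =>
    σ (idx u) u + 1 + (N u).attach.sup fun w => rec w.1 ((hN u w.1).1 w.2).1.2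
  have hρ : ∀ u, ρ u = σ (idx u) u + 1 + (N u).attach.sup fun w => ρ w.1 := fun u =>
    hwf.fix_eq _ u
  have hlt : ∀ u, ∀ w ∈ G.attachments X {v | v ∈ A ∧ idx v < idx u} u, ρ w < ρ u := by
    intro u w hw
    have h1 : ρ w ≤ (N u).attach.sup fun w => ρ w.1 :=
      Finset.le_sup (f := fun w : {x // x ∈ N u} => ρ w.1)
        (Finset.mem_attach _ ⟨w, (hN u w).2 hw⟩)
    rw [hρ u]
    omega
  have hsup : ∀ u v, N u = N v →
      ((N u).attach.sup fun w => ρ w.1) = (N v).attach.sup fun w => ρ w.1 := by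
    intro u v h
    rw [h]
  have hcross : ∀ u v, ∀ p : G.Walk u v, (∀ x ∈ p.support, x ∉ X) →
      (∃ x ∈ p.support, x ∈ {v | v ∈ A ∧ idx v < idx u}) →
      ∃ w ∈ p.support, w ∈ A ∧ ρ w < ρ u := by
    intro u v p hp h
    obtain ⟨w, hw, hwa⟩ := exists_attachment_mem_support p hp h
    exact ⟨w, hw, hwa.1.1, hlt u w hwa⟩
  refine ⟨ρ, fun u hu v hv hne huv p hp => ?_⟩
  rcases lt_trichotomy (idx u) (idx v) with h | h | h
  · rw [huv]
    obtain ⟨w, hw, hw'⟩ := hcross v u p.reverse (by simpa using hp) ⟨u, by simp, hu, h⟩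
    exact ⟨w, by simpa using hw, hw'⟩
  · by_cases hpW : ∃ x ∈ p.support, x ∈ {v | v ∈ A ∧ idx v < idx u}
    · exact hcross u v p hp hpW
    · push Not at hpW
      have hp' : ∀ x ∈ p.support, x ∉ X ∪ {v | v ∈ A ∧ idx v < idx u} := fun x hx h =>
        h.elim (hp x hx) (hpW x hx)
      -- A walk that avoids the lower layers stays in one component of the rest, where attachments
      -- agree. So along `p`, within the layer, `ρ` is `σ` plus a constant.
      have hNeq : ∀ w ∈ p.support, idx w = idx u → N w = N u := by
        classical
        intro w hw hwi
        ext y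
        rw [hN, hN, hwi]
        have hsub : ∀ x ∈ (p.takeUntil w hw).support,
            x ∉ X ∪ {v | v ∈ A ∧ idx v < idx u} := fun x hx =>
          hp' x (p.support_takeUntil_subset_support hw hx)
        exact ⟨fun h => attachments_subset_of_walk (p.takeUntil w hw) hsub h,
          fun h => attachments_subset_of_walk (p.takeUntil w hw).reverse
            (by simpa using hsub) h⟩
      have hρw : ∀ w ∈ p.support, idx w = idx u →
          ρ w = σ (idx u) w + 1 + (N u).attach.sup fun w => ρ w.1 := by
        intro w hw hwi
        rw [hρ w, hsup w u (hNeq w hw hwi), hwi]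
      have hσuv : σ (idx u) u = σ (idx u) v := by
        have h1 := hρw u p.start_mem_support rfl
        have h2 := hρw v p.end_mem_support h.symm
        omega
      obtain ⟨w, hw, ⟨hwA, hwi⟩, hlt'⟩ :=
        hσ (idx u) u ⟨hu, rfl⟩ v ⟨hv, h.symm⟩ hne hσuv p hp'
      refine ⟨w, hw, hwA, ?_⟩
      rw [hρw w hw hwi, hρw u p.start_mem_support rfl]
      omega
  · exact hcross u v p hp ⟨v, by simp, hv, h⟩

theorem exists_closure (S : V → V → Set V) (hS : ∀ u v, (S u v).Finite) (X : Set V) :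
    ∃ C : Set V, X ⊆ C ∧ (∀ u ∈ C, ∀ v ∈ C, S u v ⊆ C) ∧
      (∀ Z : Set V, X ⊆ Z → (∀ u ∈ Z, ∀ v ∈ Z, S u v ⊆ Z) → C ⊆ Z) ∧ #C ≤ max #X ℵ₀ := by
  obtain ⟨Y, hY0, hY⟩ : ∃ Y : ℕ → Set V, Y 0 = X ∧
      ∀ n, Y (n + 1) = Y n ∪ ⋃ q : Y n × Y n, S q.1 q.2 :=
    ⟨fun n => Nat.rec X (fun _ Z => Z ∪ ⋃ q : Z × Z, S q.1 q.2) n, rfl, fun _ => rfl⟩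
  have hmono : Monotone Y := monotone_nat_of_le_succ fun n => by
    rw [hY]
    exact Set.subset_union_left
  refine ⟨⋃ n, Y n, hY0.ge.trans (Set.subset_iUnion Y 0), ?_, ?_, ?_⟩
  · intro u hu v hv x hx
    obtain ⟨m, hm⟩ := Set.mem_iUnion.1 hu
    obtain ⟨n, hn⟩ := Set.mem_iUnion.1 hv
    refine Set.mem_iUnion.2 ⟨max m n + 1, ?_⟩
    rw [hY]
    exact Or.inr (Set.mem_iUnion.2 ⟨(⟨u, hmono (le_max_left m n) hm⟩,
      ⟨v, hmono (le_max_right m n) hn⟩), hx⟩)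
  · intro Z hXZ hZ
    refine Set.iUnion_subset fun n => ?_
    induction n with
    | zero => exact hY0.le.trans hXZ
    | succ n ih =>
      rw [hY]
      exact Set.union_subset ih (Set.iUnion_subset fun q => hZ _ (ih q.1.2) _ (ih q.2.2))
  · have hle : ℵ₀ ≤ max #X ℵ₀ := le_max_right _ _
    have hcard : ∀ n, #(Y n) ≤ max #X ℵ₀ := by
      intro n
      induction n with
      | zero => exact hY0 ▸ le_max_left _ _
      | succ n ih =>
        rw [hY]
        refine (mk_union_le _ _).trans (add_le_of_le hle ih ?_)
        refine (mk_iUnion_le _).trans (mul_le_of_le hle ?_ ?_)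
        · simp only [mk_prod, lift_id]
          exact mul_le_of_le hle ih ih
        · exact ciSup_le' fun q => ((hS _ _).lt_aleph0.le).trans hle
    have := mk_iUnion_le_lift (f := Y)
    refine le_trans (by simpa using this) (mul_le_of_le hle hle (ciSup_le' fun n => ?_))
    simpa using hcard n

theorem SepClosed.exists_isRanking (hK : ¬ ContainsSubdivision (⊤ : SimpleGraph ℕ) G)
    {X A : Set V} (hA : G.SepClosed X A) : ∃ ρ, G.IsRanking X A ρ := by
  classical
  -- `X` must vary, because each layer is ranked after deletion of the lower ones.
  induction hκ : #A using WellFoundedLT.induction generalizing X A with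
  | ind κ ih =>
  subst hκ
  by_cases hcount : A.Countable
  · exact exists_isRanking_of_countable X hcount
  have hunc : ℵ₀ < #A := by
    rw [← not_le]
    exact fun h => hcount (le_aleph0_iff_set_countable.1 h)
  have hS : ∀ u v, ∃ S : Set V, S.Finite ∧ (u ∈ A → v ∈ A → S ⊆ A ∧
      ((∃ S : Set V, S.Finite ∧ G.Separates X S u v) → G.Separates X S u v)) := by
    intro u v
    by_cases h : u ∈ A ∧ v ∈ A ∧ ∃ S : Set V, S.Finite ∧ G.Separates X S u v
    · obtain ⟨S, h1, h2, h3⟩ := hA u h.1 v h.2.1 h.2.2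
      exact ⟨S, h2, fun _ _ => ⟨h1, fun _ => h3⟩⟩
    · exact ⟨∅, Set.finite_empty, fun hu hv => ⟨Set.empty_subset _,
        fun h' => absurd ⟨hu, hv, h'⟩ h⟩⟩
  choose S hSfin hSsep using hS
  have hclosed : ∀ C ⊆ A, (∀ u ∈ C, ∀ v ∈ C, S u v ⊆ C) → G.SepClosed X C :=
    fun C hCA hC u hu v hv h => ⟨S u v, hC u hu v hv, hSfin u v,
      (hSsep u v (hCA hu) (hCA hv)).2 h⟩
  -- In a well-order of least possible type, all initial segments, and so their closures under the
  -- countably many rounds of adding separators, are smaller than the uncountable `A`.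
  obtain ⟨_, _, hr⟩ := Cardinal.exists_ord_eq_type_lt A
  have hseg : ∀ a : A, #(Set.Iic a) < #A := by
    intro a
    have h : Set.Iic a = insert a (Set.Iio a) := Set.Iio_insert.symm
    rw [h]
    refine (mk_insert_le).trans_lt (add_lt_of_lt hunc.le ?_ (one_lt_aleph0.trans hunc))
    exact mk_Iio_lt a hr
  choose U hU1 hU2 hU3 hU4 using fun a : A =>
    exists_closure S hSfin (Subtype.val '' Set.Iic a)
  have hUA : ∀ a, U a ⊆ A := fun a => hU3 a A (by simp) fun u hu v hv => (hSsep u v hu hv).1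
  have hUmono : Monotone U := fun a b hab =>
    hU3 a (U b) ((Set.image_mono (Set.Iic_subset_Iic.2 hab)).trans (hU1 b)) (hU2 b)
  have hUcard : ∀ a, #(U a) < #A := fun a =>
    (hU4 a).trans_lt (max_lt (mk_image_le.trans_lt (hseg a)) hunc)
  have : Nonempty A := mk_ne_zero_iff.1 (aleph0_pos.trans hunc).ne'
  -- The default value occurs only outside `A`, where layers ignore it.
  let idx : V → A := fun v => if h : ∃ a, v ∈ U a then (wellFounded_lt (α := A)).min {a | v ∈ U a} h
    else Classical.arbitrary A
  have hmem : ∀ v ∈ A, ∃ a, v ∈ U a := fun v hv => ⟨⟨v, hv⟩, hU1 _ ⟨⟨v, hv⟩, by simp, rfl⟩⟩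
  have hidx : ∀ v ∈ A, v ∈ U (idx v) := fun v hv => by
    simp only [idx, dif_pos (hmem v hv)]
    exact (wellFounded_lt (α := A)).min_mem {a | v ∈ U a} (hmem v hv)
  have hidx_le : ∀ v a, v ∈ U a → idx v ≤ a := fun v a hva => by
    simp only [idx, dif_pos (⟨a, hva⟩ : ∃ a, v ∈ U a)]
    exact (wellFounded_lt (α := A)).min_le hva
  have hUeq : ∀ a, U a = {v | v ∈ A ∧ idx v ≤ a} := fun a => by
    ext v
    exact ⟨fun h => ⟨hUA a h, hidx_le v a h⟩, fun h => hUmono h.2 (hidx v h.1)⟩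
  have hWclosed : ∀ a, G.SepClosed X {v | v ∈ A ∧ idx v < a} := by
    intro a
    refine hclosed _ (fun v hv => hv.1) ?_
    rintro u ⟨hu, hua⟩ v ⟨hv, hva⟩ x hx
    -- The larger of two indices below `a` is again below `a`, so lower layers are closed at limits
    -- too.
    have hx' : x ∈ U (max (idx u) (idx v)) :=
      hU2 _ u (hUmono (le_max_left _ _) (hidx u hu)) v (hUmono (le_max_right _ _) (hidx v hv)) hx
    exact ⟨hUA _ hx', (hidx_le _ _ hx').trans_lt (max_lt hua hva)⟩
  refine exists_isRanking_of_layers idx X A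
    (fun a => (hWclosed a).finite_attachments hK) fun a => ?_
  have hlayer : {v | v ∈ A ∧ idx v = a} = U a \ {v | v ∈ A ∧ idx v < a} := by
    ext v
    rw [hUeq]
    simp only [Set.mem_ofPred_eq, Set.mem_sdiff, not_and, not_lt]
    exact ⟨fun h => ⟨⟨h.1, h.2.le⟩, fun _ => h.2.ge⟩,
      fun h => ⟨h.1.1, le_antisymm h.1.2 (h.2 h.1.1)⟩⟩
  rw [hlayer]
  exact ih _ ((mk_le_mk_of_subset Set.sdiff_subset).trans_lt (hUcard a))
    ((hclosed _ (hUA a) (hU2 a)).diff ((hWclosed a).finite_attachments hK)) rfl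

/-! ### Trees from parent functions -/

/-- The graph that joins every vertex to its parent. -/
def parentGraph (par : V → V) : SimpleGraph V := SimpleGraph.fromRel fun u v => par v = u

theorem parentGraph_adj {par : V → V} {u v : V} :
    (parentGraph par).Adj u v ↔ u ≠ v ∧ (par v = u ∨ par u = v) :=
  SimpleGraph.fromRel_adj _ _ _

theorem exists_isPath_parentGraph {par : V → V} {ht : V → ℕ} {r : V} (hr : par r = r)
    (hpar : ∀ v, v ≠ r → ht (par v) < ht v) (v : V) :
    ∃ p : (parentGraph par).Walk r v, p.IsPath ∧ (∀ x ∈ p.support, ht x ≤ ht v) ∧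
      ∀ k, par^[k] v ∈ p.support := by
  induction hn : ht v using Nat.strong_induction_on generalizing v with
  | _ n ih =>
  subst hn
  by_cases hv : v = r
  · subst hv
    exact ⟨Walk.nil, by simp, by simp, fun k => by simp [Function.iterate_fixed hr k]⟩
  · have hlt := hpar v hv
    obtain ⟨p, hp, hp1, hp2⟩ := ih _ hlt (par v) rfl
    have hadj : (parentGraph par).Adj (par v) v :=
      parentGraph_adj.2 ⟨fun h => by rw [h] at hlt; exact lt_irrefl _ hlt, Or.inl rfl⟩
    refine ⟨p.concat hadj, hp.concat (fun h => (hp1 v h).not_gt hlt) hadj, ?_, ?_⟩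
    · intro x hx
      rw [Walk.support_concat, List.mem_append, List.mem_singleton] at hx
      rcases hx with hx | rfl
      · exact (hp1 x hx).trans hlt.le
      · exact le_rfl
    · intro k
      rw [Walk.support_concat, List.mem_append, List.mem_singleton]
      cases k with
      | zero => exact Or.inr rfl
      | succ k => exact Or.inl (by rw [Function.iterate_succ_apply]; exact hp2 k)

/-- Every edge is a bridge: the parent of `v` has smaller height, hence is no descendant of `v`, and
the descendants of `v` can be left only along the edge to the parent. -/
theorem isAcyclic_parentGraph {par : V → V} {ht : V → ℕ} {r : V} (hr : par r = r)
    (hpar : ∀ v, v ≠ r → ht (par v) < ht v) : (parentGraph par).IsAcyclic := by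
  have hle : ∀ k v, ht (par^[k] v) ≤ ht v := by
    intro k
    induction k with
    | zero => exact fun v => le_rfl
    | succ k ih =>
      intro v
      rw [Function.iterate_succ_apply]
      refine (ih _).trans ?_
      by_cases hv : v = r
      · rw [hv, hr]
      · exact (hpar v hv).le
  -- A walk leaving the descendants of `v` uses the edge from `v` to its parent.
  have hdesc : ∀ v a b, ∀ p : (parentGraph par).Walk a b, (∃ k, par^[k] a = v) →
      (∃ k, par^[k] b = v) ∨ s(v, par v) ∈ p.edges := by
    intro v a b p
    induction p with
    | nil => exact Or.inl
    | @cons a b c hab p ih =>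
      rintro ⟨k, hk⟩
      rw [Walk.edges_cons, List.mem_cons]
      by_cases hb : ∃ k, par^[k] b = v
      · exact (ih hb).imp_right Or.inr
      · refine Or.inr (Or.inl ?_)
        rcases (parentGraph_adj.1 hab).2 with h | h
        · exact absurd ⟨k + 1, by rw [Function.iterate_succ_apply, h, hk]⟩ hb
        · cases k with
          | zero => rw [← hk, ← h]; rfl
          | succ k =>
            rw [Function.iterate_succ_apply, h] at hk
            exact absurd ⟨k, hk⟩ hb
  have hbridge : ∀ v, v ≠ par v → (parentGraph par).IsBridge s(v, par v) := by
    intro v hv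
    rw [isBridge_iff_forall_walk_mem_edges]
    intro p
    refine (hdesc v v (par v) p ⟨0, rfl⟩).resolve_left ?_
    rintro ⟨k, hk⟩
    have h1 := hle k (par v)
    rw [hk] at h1
    exact h1.not_gt (hpar v fun h => hv (by rw [h, hr]))
  rw [isAcyclic_iff_forall_adj_isBridge]
  intro u v huv
  obtain ⟨hne, h | h⟩ := parentGraph_adj.1 huv
  · rw [Sym2.eq_swap, ← h]
    exact hbridge v fun h' => hne (by rw [← h, ← h'])
  · rw [← h]
    exact hbridge u fun h' => hne (by rw [h', h])

theorem isNormalSpanningTree_parentGraph {par : V → V} {ht : V → ℕ} {r : V} (hr : par r = r)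
    (hpar : ∀ v, v ≠ r → G.Adj (par v) v ∧ ht (par v) < ht v)
    (hcomp : ∀ u v, G.Adj u v → (∃ k, par^[k] v = u) ∨ ∃ k, par^[k] u = v) :
    IsNormalSpanningTree G (parentGraph par) r where
  le := by
    intro u v huv
    obtain ⟨hne, h | h⟩ := parentGraph_adj.1 huv
    · rw [← h]
      exact (hpar v fun hv => hne (by rw [← h, hv, hr])).1
    · rw [← h]
      exact (hpar u fun hu => hne (by rw [← h, hu, hr])).1.symm
  isTree := by
    refine ⟨?_, isAcyclic_parentGraph hr fun v hv => (hpar v hv).2⟩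
    rw [connected_iff_exists_forall_reachable]
    refine ⟨r, fun v => ?_⟩
    obtain ⟨p, -⟩ := exists_isPath_parentGraph hr (fun v hv => (hpar v hv).2) v
    exact ⟨p⟩
  comparable := by
    have key : ∀ u v, (∃ k, par^[k] v = u) → TreeLE (parentGraph par) r u v := by
      rintro _ v ⟨k, rfl⟩
      obtain ⟨p, hp, -, hk⟩ := exists_isPath_parentGraph hr (fun v hv => (hpar v hv).2) v
      exact ⟨p, hp, hk k⟩
    exact fun u v huv => (hcomp u v huv).imp (key u v) (key v u)

/-! ### Components and the depth-first search -/

/-- The vertex set of the component of `G - F` that contains `v` (empty if `v ∈ F`). -/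
def compAvoiding (G : SimpleGraph V) (F : Set V) (v : V) : Set V :=
  {x | ∃ p : G.Walk v x, ∀ y ∈ p.support, y ∉ F}

theorem mem_compAvoiding_self {F : Set V} {v : V} (h : v ∉ F) : v ∈ G.compAvoiding F v :=
  ⟨Walk.nil, by simpa using h⟩

theorem notMem_of_mem_compAvoiding {F : Set V} {v w : V} (h : w ∈ G.compAvoiding F v) : w ∉ F := by
  obtain ⟨p, hp⟩ := h
  exact hp w p.end_mem_support

theorem compAvoiding_anti {F F' : Set V} (h : F ⊆ F') (v : V) :
    G.compAvoiding F' v ⊆ G.compAvoiding F v := fun _ ⟨p, hp⟩ => ⟨p, fun y hy hyF => hp y hy (h hyF)⟩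

theorem mem_compAvoiding_trans {F : Set V} {u v w : V} (h : v ∈ G.compAvoiding F u)
    (h' : w ∈ G.compAvoiding F v) : w ∈ G.compAvoiding F u := by
  obtain ⟨p, hp⟩ := h
  obtain ⟨q, hq⟩ := h'
  refine ⟨p.append q, fun y hy => ?_⟩
  rw [Walk.mem_support_append_iff] at hy
  exact hy.elim (hp y) (hq y)

theorem mem_compAvoiding_symm {F : Set V} {u v : V} (h : v ∈ G.compAvoiding F u) :
    u ∈ G.compAvoiding F v := by
  obtain ⟨p, hp⟩ := h
  exact ⟨p.reverse, by simpa using hp⟩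

theorem compAvoiding_eq_of_mem {F : Set V} {u v : V} (h : v ∈ G.compAvoiding F u) :
    G.compAvoiding F v = G.compAvoiding F u :=
  Set.Subset.antisymm (fun _ => mem_compAvoiding_trans h)
    fun _ => mem_compAvoiding_trans (mem_compAvoiding_symm h)

theorem mem_compAvoiding_of_mem_support {F : Set V} {u v w x : V} (hu : u ∈ G.compAvoiding F w)
    (p : G.Walk u v) (hp : ∀ y ∈ p.support, y ∉ F) (hx : x ∈ p.support) :
    x ∈ G.compAvoiding F w := by
  classical
  exact mem_compAvoiding_trans hu
    ⟨p.takeUntil x hx, fun y hy => hp y (p.support_takeUntil_subset_support hx hy)⟩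

theorem exists_adj_mem_compAvoiding_insert {F : Set V} {v t : V} (hvt : v ≠ t)
    (h : t ∈ G.compAvoiding F v) : ∃ s ∈ G.compAvoiding (insert t F) v, G.Adj t s := by
  obtain ⟨p, hp⟩ := h
  induction p with
  | nil => exact absurd rfl hvt
  | @cons a b c hab p ih =>
    have ha : a ∉ insert c F := fun h => h.elim hvt (hp a (by simp))
    by_cases hb : b = c
    · subst hb
      exact ⟨a, mem_compAvoiding_self ha, hab.symm⟩
    · obtain ⟨s, hs, hts⟩ := ih hb fun y hy => hp y (by simp [hy])
      have hbF := notMem_of_mem_compAvoiding (mem_compAvoiding_symm hs)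
      refine ⟨s, mem_compAvoiding_trans ⟨hab.toWalk, ?_⟩ hs, hts⟩
      intro y hy
      have : y = a ∨ y = b := by simpa using hy
      rcases this with rfl | rfl
      · exact ha
      · exact hbF

/-- The search for `v` from `r`: the set of vertices visited before step `n` and the vertex visited
in step `n`. After visiting `t`, the search moves on to `pick D t`, where `D` is the component
containing `v` that remains after deleting all visited vertices. -/
def search (G : SimpleGraph V) (pick : Set V → V → V) (r v : V) : ℕ → Set V × V
  | 0 => (∅, r)
  | n + 1 =>
    (insert (search G pick r v n).2 (search G pick r v n).1,
      pick (G.compAvoiding (insert (search G pick r v n).2 (search G pick r v n).1) v)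
        (search G pick r v n).2)

section search

variable {pick : Set V → V → V} {r : V}

/-- The next vertex depends only on the current one and the remaining component, so targets in the
same component share their search. -/
theorem search_eq_of_mem {v w : V} (n : ℕ)
    (h : w ∈ G.compAvoiding (G.search pick r v n).1 v) :
    G.search pick r w n = G.search pick r v n := by
  induction n with
  | zero => rfl
  | succ n ih =>
    have h' := ih (compAvoiding_anti (Set.subset_insert _ _) v h)
    simp only [search] at h ⊢
    rw [h', compAvoiding_eq_of_mem h]

theorem mem_search_fst {v x : V} (n : ℕ) :
    x ∈ (G.search pick r v n).1 ↔ ∃ j < n, (G.search pick r v j).2 = x := by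
  induction n with
  | zero => simp [search]
  | succ n ih =>
    simp only [search, Set.mem_insert_iff, ih, Nat.lt_succ_iff_lt_or_eq]
    constructor
    · rintro (rfl | ⟨j, hj, rfl⟩)
      · exact ⟨n, Or.inr rfl, rfl⟩
      · exact ⟨j, Or.inl hj, rfl⟩
    · rintro ⟨j, hj | rfl, rfl⟩
      · exact Or.inr ⟨j, hj, rfl⟩
      · exact Or.inl rfl

theorem search_snd_mem (hG : G.Preconnected)
    (hpick : ∀ D t, (∃ s ∈ D, G.Adj t s) → pick D t ∈ D ∧ G.Adj t (pick D t)) {v : V} (n : ℕ)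
    (h : v ∉ (G.search pick r v n).1) :
    (G.search pick r v n).2 ∈ G.compAvoiding (G.search pick r v n).1 v := by
  induction n with
  | zero =>
    obtain ⟨p⟩ := hG v r
    exact ⟨p, by simp [search]⟩
  | succ n ih =>
    simp only [search, Set.mem_insert_iff, not_or] at h ⊢
    exact (hpick _ _ (exists_adj_mem_compAvoiding_insert h.1 (ih h.2))).1

theorem search_adj (hG : G.Preconnected)
    (hpick : ∀ D t, (∃ s ∈ D, G.Adj t s) → pick D t ∈ D ∧ G.Adj t (pick D t)) {v : V} (n : ℕ)
    (h : v ∉ (G.search pick r v (n + 1)).1) :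
    G.Adj (G.search pick r v n).2 (G.search pick r v (n + 1)).2 := by
  simp only [search, Set.mem_insert_iff, not_or] at h ⊢
  exact (hpick _ _ (exists_adj_mem_compAvoiding_insert h.1 (search_snd_mem hG hpick n h.2))).2

/-- If the search finds every vertex, then the visits form a normal spanning tree. -/
theorem exists_isNormalSpanningTree_of_search (hG : G.Preconnected)
    (hpick : ∀ D t, (∃ s ∈ D, G.Adj t s) → pick D t ∈ D ∧ G.Adj t (pick D t))
    (hfind : ∀ v, ∃ n, (G.search pick r v n).2 = v) :
    ∃ T : SimpleGraph V, IsNormalSpanningTree G T r := by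
  classical
  let lvl : V → ℕ := fun v => Nat.find (hfind v)
  have hlvl : ∀ v, (G.search pick r v (lvl v)).2 = v := fun v => Nat.find_spec (hfind v)
  have hnot : ∀ v n, n ≤ lvl v → v ∉ (G.search pick r v n).1 := by
    intro v n hn h
    obtain ⟨j, hj, hjv⟩ := (mem_search_fst n).1 h
    exact Nat.find_min (hfind v) (hj.trans_le hn) hjv
  have hmem : ∀ v n, n ≤ lvl v →
      (G.search pick r v n).2 ∈ G.compAvoiding (G.search pick r v n).1 v := fun v n hn =>
    search_snd_mem hG hpick n (hnot v n hn)
  have hlvl_visit : ∀ v n, n ≤ lvl v → lvl (G.search pick r v n).2 = n := by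
    intro v n hn
    have h := search_eq_of_mem n (hmem v n hn)
    refine (Nat.find_eq_iff _).2 ⟨by rw [h], fun j hj hcon => ?_⟩
    have h' := (mem_search_fst n).2 ⟨j, hj, hcon⟩
    rw [h] at h'
    exact notMem_of_mem_compAvoiding (hmem v n hn) h'
  -- At the root the truncated subtraction `0 - 1 = 0` makes `r` its own parent.
  let par : V → V := fun v => (G.search pick r v (lvl v - 1)).2
  have hpar : ∀ v n, n + 1 ≤ lvl v →
      par (G.search pick r v (n + 1)).2 = (G.search pick r v n).2 := by
    intro v n hn
    simp only [par]
    rw [hlvl_visit v _ hn, Nat.add_sub_cancel,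
      search_eq_of_mem n (compAvoiding_anti (Set.subset_insert _ _) v (hmem v (n + 1) hn))]
  have hiter : ∀ v k n, n + k ≤ lvl v →
      par^[k] (G.search pick r v (n + k)).2 = (G.search pick r v n).2 := by
    intro v k
    induction k with
    | zero => exact fun n _ => rfl
    | succ k ih =>
      intro n hn
      rw [Function.iterate_succ_apply, ← add_assoc, hpar v (n + k) hn]
      exact ih n (by omega)
  have hlvl0 : ∀ v, v ≠ r → lvl v ≠ 0 := by
    intro v hv h
    have := hlvl v
    rw [h] at this
    exact hv this.symm
  refine ⟨parentGraph par, isNormalSpanningTree_parentGraph (ht := lvl) ?_ ?_ ?_⟩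
  · have : lvl r = 0 := (Nat.find_eq_zero _).2 rfl
    simp only [par, this]
    rfl
  · intro v hv
    obtain ⟨n, hn⟩ := Nat.exists_eq_succ_of_ne_zero (hlvl0 v hv)
    have hv' := hlvl v
    rw [hn] at hv'
    have hp := hpar v n hn.ge
    rw [hv'] at hp
    rw [hp, hlvl_visit v n (by omega), hn]
    have hadj := search_adj hG hpick n (hnot v (n + 1) hn.ge)
    rw [hv'] at hadj
    exact ⟨hadj, n.lt_succ_self⟩
  -- The edge `uv` keeps both ends in one component until one is visited. So the search for `v`
  -- visits `u` in step `lvl u`, and iterating the parent map from `v` leads back to `u`.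
  · have key : ∀ u v, G.Adj u v → lvl u ≤ lvl v → ∃ k, par^[k] v = u := by
      intro u v huv hle
      have hstep : ∀ j, j ≤ lvl u → u ∉ (G.search pick r v j).1 →
          G.search pick r u j = G.search pick r v j := by
        intro j hj hu
        refine search_eq_of_mem j ⟨huv.symm.toWalk, fun y hy => ?_⟩
        have : y = v ∨ y = u := by simpa using hy
        rcases this with rfl | rfl
        · exact hnot y j (hj.trans hle)
        · exact hu
      have hu : ∀ j, j ≤ lvl u → u ∉ (G.search pick r v j).1 := by
        intro j
        induction j with
        | zero => simp [search]
        | succ j ih =>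
          intro hj
          have h := hnot u (j + 1) hj
          have he := hstep j (by omega) (ih (by omega))
          simp only [search] at h ⊢
          rwa [he] at h
      have he := hstep _ le_rfl (hu _ le_rfl)
      refine ⟨lvl v - lvl u, ?_⟩
      have := hiter v (lvl v - lvl u) (lvl u) (by omega)
      rw [Nat.add_sub_cancel' hle, hlvl v, ← he, hlvl u] at this
      exact this
    intro u v huv
    rcases le_total (lvl u) (lvl v) with h | h
    · exact Or.inl (key u v huv h)
    · exact Or.inr (key v u huv.symm h)

end search

/-! ### From a ranking to a normal spanning tree -/

/-- The least length of a walk from `s` to `m` inside `D`. -/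
noncomputable def distWithin (G : SimpleGraph V) (D : Set V) (s m : V) : ℕ :=
  sInf {n | ∃ p : G.Walk s m, (∀ x ∈ p.support, x ∈ D) ∧ p.length = n}

/-- The second vertex of a shortest path from `t` to `m` works: the remainder avoids `t` and ends in
the new component, so it lies there entirely. -/
theorem exists_adj_distWithin_lt {F : Set V} {v t m : V} (ht : t ∈ G.compAvoiding F v)
    (hm : m ∈ G.compAvoiding (insert t F) v) :
    ∃ s ∈ G.compAvoiding (insert t F) v, G.Adj t s ∧
      G.distWithin (G.compAvoiding (insert t F) v) s m < G.distWithin (G.compAvoiding F v) t m := by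
  classical
  have hmF := notMem_of_mem_compAvoiding hm
  obtain ⟨q, hq⟩ : m ∈ G.compAvoiding F t := by
    rw [compAvoiding_eq_of_mem ht]
    exact compAvoiding_anti (Set.subset_insert _ _) v hm
  obtain ⟨p, hpD, hpl⟩ := Nat.sInf_mem (s := {n | ∃ p : G.Walk t m,
    (∀ x ∈ p.support, x ∈ G.compAvoiding F v) ∧ p.length = n})
    ⟨q.length, q, fun x hx => mem_compAvoiding_of_mem_support ht q hq hx, rfl⟩
  have hpl' : p.bypass.length ≤ G.distWithin (G.compAvoiding F v) t m :=
    p.length_bypass_le_length.trans hpl.le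
  have hbD : ∀ x ∈ p.bypass.support, x ∈ G.compAvoiding F v := fun x hx =>
    hpD x (p.support_bypass_subset_support hx)
  have hpath := p.bypass_isPath
  generalize p.bypass = b at hpl' hbD hpath
  cases b with
  | nil => exact absurd (Set.mem_insert _ _) hmF
  | @cons _ s _ hts b =>
    rw [Walk.cons_isPath_iff] at hpath
    have hav : ∀ y ∈ b.support, y ∉ insert t F := by
      rintro y hy (rfl | hyF)
      · exact hpath.2 hy
      · exact notMem_of_mem_compAvoiding (hbD y (by simp [hy])) hyF
    have hb : ∀ y ∈ b.support, y ∈ G.compAvoiding (insert t F) v := by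
      intro y hy
      exact mem_compAvoiding_of_mem_support hm b.reverse (by simpa using hav) (by simpa using hy)
    refine ⟨s, hb s b.start_mem_support, hts, ?_⟩
    have : G.distWithin (G.compAvoiding (insert t F) v) s m ≤ b.length :=
      Nat.sInf_le ⟨b, hb, rfl⟩
    rw [Walk.length_cons] at hpl'
    omega

/-- A connected graph with a vertex ranking by natural numbers has a normal spanning tree. -/
theorem exists_isNormalSpanningTree_of_isRanking (hG : G.Connected) {ρ : V → ℕ}
    (hρ : G.IsRanking ∅ Set.univ ρ) :
    ∃ (T : SimpleGraph V) (r : V), IsNormalSpanningTree G T r := by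
  classical
  obtain ⟨r⟩ := hG.nonempty
  have hmin : ∀ D : Set V, ∃ m, D.Nonempty → m ∈ D ∧ ∀ x ∈ D, ρ m ≤ ρ x := by
    intro D
    by_cases hD : D.Nonempty
    · exact ⟨Function.argminOn ρ D hD, fun _ => ⟨Function.argminOn_mem ρ D hD,
        fun x hx => Function.argminOn_le ρ D hx⟩⟩
    · exact ⟨r, fun h => absurd h hD⟩
  choose m hm using hmin
  have hpick : ∀ (D : Set V) (t : V), ∃ s, (∃ s' ∈ D, G.Adj t s') → (s ∈ D ∧ G.Adj t s) ∧
      ∀ s' ∈ D, G.Adj t s' → G.distWithin D s (m D) ≤ G.distWithin D s' (m D) := by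
    intro D t
    by_cases hD : {s | s ∈ D ∧ G.Adj t s}.Nonempty
    · exact ⟨Function.argminOn (fun s => G.distWithin D s (m D)) {s | s ∈ D ∧ G.Adj t s} hD, fun _ =>
        ⟨Function.argminOn_mem (fun s => G.distWithin D s (m D)) {s | s ∈ D ∧ G.Adj t s} hD, fun s' hs' hts' =>
          Function.argminOn_le (fun s => G.distWithin D s (m D)) {s | s ∈ D ∧ G.Adj t s}
            (a := s') ⟨hs', hts'⟩⟩⟩
    · exact ⟨r, fun ⟨s, h⟩ => absurd ⟨s, h⟩ hD⟩
  choose pick hpick using hpick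
  obtain ⟨T, hT⟩ := exists_isNormalSpanningTree_of_search (r := r) (pick := pick) hG.preconnected
    (fun D t h => (hpick D t h).1) (by
      intro v
      by_contra! hcon
      have hv : ∀ n, v ∉ (G.search pick r v n).1 := by
        intro n h
        obtain ⟨j, -, hj⟩ := (mem_search_fst n).1 h
        exact hcon j hj
      let D : ℕ → Set V := fun n => G.compAvoiding (G.search pick r v n).1 v
      have hvD : ∀ n, v ∈ D n := fun n => mem_compAvoiding_self (hv n)
      have hD : ∀ n, D (n + 1) ⊆ D n := fun n => compAvoiding_anti (Set.subset_insert _ _) v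
      have hmD : ∀ n, m (D n) ∈ D n := fun n => (hm (D n) ⟨v, hvD n⟩).1
      have hmle : ∀ n, ∀ x ∈ D n, ρ (m (D n)) ≤ ρ x := fun n => (hm (D n) ⟨v, hvD n⟩).2
      have huniq : ∀ n, ∀ x ∈ D n, ρ x = ρ (m (D n)) → x = m (D n) := by
        intro n x hx hxm
        by_contra hne
        obtain ⟨p, hp⟩ := mem_compAvoiding_trans (mem_compAvoiding_symm hx) (hmD n)
        obtain ⟨w, hw, -, hlt⟩ := hρ x trivial _ trivial hne hxm p (by simp)
        have := hmle n w (mem_compAvoiding_of_mem_support hx p hp hw)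
        omega
      -- As components shrink, the least rank never decreases and stays at most `ρ v`. If it is
      -- unchanged, so is the target, by uniqueness, and the distance to it drops. Thus `f` would
      -- descend forever.
      let f : ℕ → ℕ ×ₗ ℕ := fun n => toLex
        (ρ v - ρ (m (D n)), G.distWithin (D n) (G.search pick r v n).2 (m (D n)))
      obtain ⟨n, hn⟩ := WellFounded.not_rel_apply_succ (r := (· < ·)) f
      refine hn (Prod.Lex.toLex_lt_toLex.2 ?_)
      have h1 := hmle n _ (hD n (hmD (n + 1)))
      have h2 := hmle (n + 1) v (hvD (n + 1))
      rcases h1.lt_or_eq with hlt | heq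
      · exact Or.inl (by simp only; omega)
      · have hmm : m (D (n + 1)) = m (D n) := huniq n _ (hD n (hmD (n + 1))) heq.symm
        refine Or.inr ⟨by simp only [hmm], ?_⟩
        obtain ⟨s, hs, hts, hlt⟩ := exists_adj_distWithin_lt
          (search_snd_mem hG.preconnected (fun D t h => (hpick D t h).1) n (hv n))
          (hmD (n + 1))
        refine lt_of_le_of_lt ((hpick _ _ ⟨s, hs, hts⟩).2 s hs hts) ?_
        simp only [hmm] at hlt ⊢
        exact hmm ▸ hlt)
  exact ⟨T, r, hT⟩

end SimpleGraph

theorem theorem2 {V : Type*} (G : SimpleGraph V) (hG : G.Connected)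
    (hK : ¬ ContainsSubdivision (⊤ : SimpleGraph ℕ) G) :
    ∃ (T : SimpleGraph V) (r : V), IsNormalSpanningTree G T r := by
  -- The whole vertex set trivially contains all separators.
  obtain ⟨ρ, hρ⟩ := SimpleGraph.SepClosed.exists_isRanking hK (X := ∅) (A := Set.univ)
    fun u _ v _ ⟨S, hS, h⟩ => ⟨S, Set.subset_univ S, hS, h⟩
  exact SimpleGraph.exists_isNormalSpanningTree_of_isRanking hG hρ
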